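/- Let $G$ be a simple 4-chromatic graph with a fixed embedding in the plane (vertices are distinct points, each edge is a simple arc joining its end vertices and containing no other vertex, and two different edges meet only in common end vertices). Let $(v_1, C_1, v_2, C_2, \dots, C_{n-1}, v_n)$, $n \ge 1$, be a 4-chromatic color fixation chain in $G$; that is, $v_1,\dots,v_n$ are vertices of $G$, each $C_i$ is a 3-critical subgraph of $G$ (equivalently, an odd cycle), for every $i<n$ both $v_i$ and $v_{i+1}$ are directly color fixed by $C_i$, and $C_i$ and (if $i+1<n$) $C_{i+1}$ are directly color fixed by $v_{i+1}$. Here, a subgraph $S$ of $G$ is directly color fixed by a subgraph $R$ if every vertex of $S$ is adjacent to every vertex of $R$, the chromatic numbers $j$ of $R$ and $4-j$ of $S$ add up to $4$, and in every coloring of $G$ with the color set $\{1,2,3,4\}$ in which $R$ has exactly the colors of a set $Z$ with $|Z|=j$, $S$ has exactly the colors of $\{1,2,3,4\}\setminus Z$; a vertex is regarded as a one-vertex subgraph. Then no two distinct vertices among $v_1,\dots,v_n$ are adjaceable. Here, two vertices $x,y$ of $G$ are adjaceable if they are not adjacent and there is no cycle $X$ of $G$ such that $x$ and $y$ are on opposite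 sides of $X$, i.e. such that $x$ and $y$ do not lie on the closed curve formed by the edges of $X$ and are in different connected components of the complement of that curve in the plane. -/

import Mathlib

namespace ColorFixation

universe u

variable {V : Type u}

/-- An embedding of a graph in the plane `ℂ`: vertices are distinct points, every edge is a simple
arc joining the points of its end vertices, a curve passes through no vertex other than its end
vertices, and two different curves meet only in end points. The value of `curve` matters only on
edges; it is the point set of the arc, so it does not depend on a direction of the edge. -/
structure PlaneEmbedding (G : SimpleGraph V) where
  point : V → ℂ
  curve : Sym2 V → Set ℂ
  point_injective : Function.Injective point
  curve_isArc : ∀ x y : V, G.Adj x y →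
    ∃ γ : Path (point x) (point y), Function.Injective γ ∧ Set.range γ = curve s(x, y)
  mem_of_point_mem_curve : ∀ e ∈ G.edgeSet, ∀ w : V, point w ∈ curve e → w ∈ e
  curve_inter_subset : ∀ e ∈ G.edgeSet, ∀ f ∈ G.edgeSet, e ≠ f →
    curve e ∩ curve f ⊆ point '' {w | w ∈ e ∧ w ∈ f}

/-- The closed curve that represents a closed walk: the union of the curves of its edges. -/
def PlaneEmbedding.closedCurve {G : SimpleGraph V} (P : PlaneEmbedding G) {a : V}
    (X : G.Walk a a) : Set ℂ :=
  ⋃ e ∈ X.edges, P.curve e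

/-- `x` and `y` are on opposite sides of `X`: neither point is on the closed curve, and they are in
different connected components of its complement. -/
def PlaneEmbedding.OppositeSides {G : SimpleGraph V} (P : PlaneEmbedding G) {a : V}
    (X : G.Walk a a) (x y : V) : Prop :=
  P.point x ∉ P.closedCurve X ∧ P.point y ∉ P.closedCurve X ∧
    connectedComponentIn (P.closedCurve X)ᶜ (P.point x) ≠
      connectedComponentIn (P.closedCurve X)ᶜ (P.point y)

/-- `x` and `y` are adjaceable: they are not adjacent, and no cycle of the graph has them on
opposite sides. -/
def PlaneEmbedding.Adjaceable {G : SimpleGraph V} (P : PlaneEmbedding G) (x y : V) : Prop :=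
  ¬ G.Adj x y ∧ ¬ ∃ (a : V) (X : G.Walk a a), X.IsCycle ∧ P.OppositeSides X x y

/-- A subgraph is `k`-critical if it is `k`-chromatic and every proper subgraph of it has smaller
chromatic number. -/
def IsCritical {G : SimpleGraph V} (k : ℕ) (C : G.Subgraph) : Prop :=
  C.coe.chromaticNumber = (k : ℕ∞) ∧ ∀ D : G.Subgraph, D < C → D.coe.chromaticNumber < (k : ℕ∞)

/-- `S` is color fixed by `R` with respect to the `k`-colorings of `G`: for some `j ≤ k` the
subgraph `R` is `j`-chromatic and `S` is `(k - j)`-chromatic, and in every `k`-coloring in which `R`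
has exactly the colors of a `j`-set `Z`, `S` has exactly the colors outside `Z`. -/
def ColorFixedBy {G : SimpleGraph V} (k : ℕ) (S R : G.Subgraph) : Prop :=
  ∃ j l : ℕ, j + l = k ∧ R.coe.chromaticNumber = (j : ℕ∞) ∧ S.coe.chromaticNumber = (l : ℕ∞) ∧
    ∀ (c : G.Coloring (Fin k)) (Z : Finset (Fin k)), Z.card = j →
      c '' R.verts = (Z : Set (Fin k)) → c '' S.verts = (Z : Set (Fin k))ᶜ

/-- `S` is directly color fixed by `R`: it is color fixed by `R`, and every vertex of `S` is
adjacent to every vertex of `R`. -/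
def DirectlyColorFixedBy {G : SimpleGraph V} (k : ℕ) (S R : G.Subgraph) : Prop :=
  ColorFixedBy k S R ∧ ∀ s ∈ S.verts, ∀ r ∈ R.verts, G.Adj s r

/-- `(v 0, C 0, v 1, C 1, …, C (n - 1), v n)` is a color fixation chain for `k` colors. No node is
required to be different from another. -/
structure IsColorFixationChain (G : SimpleGraph V) (k : ℕ) {n : ℕ} (v : Fin (n + 1) → V)
    (C : Fin n → G.Subgraph) : Prop where
  critical : ∀ i : Fin n, IsCritical (k - 1) (C i)
  vertex_fixed : ∀ i : Fin n, DirectlyColorFixedBy k (G.singletonSubgraph (v i.castSucc)) (C i)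
  vertex_succ_fixed : ∀ i : Fin n, DirectlyColorFixedBy k (G.singletonSubgraph (v i.succ)) (C i)
  cycle_fixed : ∀ i : Fin n, DirectlyColorFixedBy k (C i) (G.singletonSubgraph (v i.succ))
  cycle_succ_fixed : ∀ i j : Fin n, (j : ℕ) = (i : ℕ) + 1 →
    DirectlyColorFixedBy k (C j) (G.singletonSubgraph (v i.succ))

end ColorFixation

/-!
In a `4`-coloring all vertices of the chain have the same color, so they are pairwise nonadjacent.
Walk along the chain from `x` to `y`, and let `X` be the cycle that follows the last visit to `x`,
leading to a vertex `z`. Since `K₅` is not planar, `X` separates `x` from `z`. The separation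
persists along the rest of the chain: consecutive vertices are joined to a common cycle `X'`; a
vertex of `X'` off `X` connects them without meeting `X`, and if all of `X'` lies on `X`, then the
next vertex has three common neighbors with `x` on `X`, so `K₅` rules out the side of `x` again.

The nonplanarity of `K₅` is proved with continuous logarithms. Let `Δ(γ, z)` be the increment of a
continuous `log (γ - z)` along an arc `γ`. Disjoint arcs `γ` from `a` to `b` and `δ` from `c` to `d`
satisfy `Δ(δ, b) - Δ(δ, a) = Δ(γ, d) - Δ(γ, c)`. In a planar `K₅`, these relations identify the sum
over the corners of a curved triangle of the increments of the opposite sides, whose exponential is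
`-1`, with the increment around the triangle seen from a fourth vertex, whose exponential is `1`.
-/

namespace ColorFixation

open Complex Set SimpleGraph

theorem exists_continuous_exp_eq {X : Type*} [TopologicalSpace X] [SimplyConnectedSpace X]
    [LocallyPathConnectedSpace X] {f : X → ℂ} (hf : Continuous f) (h0 : ∀ x, f x ≠ 0) :
    ∃ L : X → ℂ, Continuous L ∧ ∀ x, exp (L x) = f x := by
  obtain ⟨L, hL, hLf⟩ := exists_continuousOn_eqOn_exp_comp (U := univ)
    (Homeomorph.Set.univ X).toHomotopyEquiv.simplyConnectedSpace
    isOpen_univ hf.continuousOn (by simpa using h0)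
  exact ⟨L, continuousOn_univ.1 hL, fun x ↦ hLf (mem_univ x)⟩

theorem sub_eq_sub_of_exp_eq_const_mul_exp {X : Type*} [TopologicalSpace X] [PreconnectedSpace X]
    {L M : X → ℂ} (hL : Continuous L) (hM : Continuous M) {ζ : ℂ}
    (h : ∀ x, exp (L x) = ζ * exp (M x)) (x y : X) : L y - L x = M y - M x := by
  have hconst : L y - M y = L x - M x :=
    isCoveringMap_exp.const_of_comp (hL.sub hM) (fun a b ↦ Subtype.ext <| by
      simp only [Pi.sub_apply, exp_sub, h, mul_div_cancel_right₀ _ (exp_ne_zero _)]) y x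
  linear_combination hconst

open Classical in
/-- The increment of a continuous logarithm of `γ - z` along `γ`. Its imaginary part is the angle
that `γ` sweeps out as seen from `z`. The value is `0` when `γ` passes through `z`. -/
noncomputable def logIncrement {a b : ℂ} (γ : Path a b) (z : ℂ) : ℂ :=
  if h : ∃ L : ℝ → ℂ, Continuous L ∧ ∀ t, exp (L t) = γ.extend t - z then
    h.choose 1 - h.choose 0
  else 0

section LogIncrement

variable {a b c d z w : ℂ}

theorem logIncrement_eq {γ : Path a b} {L : ℝ → ℂ} (hL : Continuous L) {ζ : ℂ}
    (h : ∀ t, exp (L t) = ζ * (γ.extend t - z)) : logIncrement γ z = L 1 - L 0 := by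
  have hζ : ζ ≠ 0 := left_ne_zero_of_mul (h 0 ▸ exp_ne_zero _)
  have hex : ∃ M : ℝ → ℂ, Continuous M ∧ ∀ t, exp (M t) = γ.extend t - z :=
    ⟨fun t ↦ L t - log ζ, by fun_prop, fun t ↦ by
      rw [exp_sub, exp_log hζ, h, mul_div_cancel_left₀ _ hζ]⟩
  rw [logIncrement, dif_pos hex]
  obtain ⟨hM, hMe⟩ := hex.choose_spec
  exact (sub_eq_sub_of_exp_eq_const_mul_exp hL hM (fun t ↦ by rw [h, hMe]) 0 1).symm

theorem exp_logIncrement {γ : Path a b} (hz : z ∉ range γ) :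
    exp (logIncrement γ z) = (b - z) / (a - z) := by
  obtain ⟨L, hL, hLe⟩ := exists_continuous_exp_eq (f := fun t ↦ γ.extend t - z) (by fun_prop)
    fun t h ↦ hz (γ.extend_range ▸ ⟨t, sub_eq_zero.1 h⟩)
  rw [logIncrement_eq hL (ζ := 1) (by simpa using hLe), exp_sub, hLe, hLe, γ.extend_one,
    γ.extend_zero]

/-- Both sides are read off a continuous logarithm of `δ t - γ s` on the square of all `(s, t)`. -/
theorem logIncrement_sub_logIncrement {γ : Path a b} {δ : Path c d}
    (h : Disjoint (range γ) (range δ)) :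
    logIncrement δ b - logIncrement δ a = logIncrement γ d - logIncrement γ c := by
  obtain ⟨M, hM, hMe⟩ := exists_continuous_exp_eq (X := ℝ × ℝ)
    (f := fun p ↦ δ.extend p.2 - γ.extend p.1) (by fun_prop) fun p hp ↦
      disjoint_left.1 h (γ.extend_range ▸ mem_range_self p.1)
        (δ.extend_range ▸ ⟨p.2, sub_eq_zero.1 hp⟩)
  have hδa : logIncrement δ a = M (0, 1) - M (0, 0) :=
    logIncrement_eq (L := fun t ↦ M (0, t)) (ζ := 1) (by fun_prop) fun t ↦ by simp [hMe]
  have hδb : logIncrement δ b = M (1, 1) - M (1, 0) :=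
    logIncrement_eq (L := fun t ↦ M (1, t)) (ζ := 1) (by fun_prop) fun t ↦ by simp [hMe]
  have hγc : logIncrement γ c = M (1, 0) - M (0, 0) :=
    logIncrement_eq (L := fun s ↦ M (s, 0)) (ζ := -1) (by fun_prop) fun s ↦ by simp [hMe]
  have hγd : logIncrement γ d = M (1, 1) - M (0, 1) :=
    logIncrement_eq (L := fun s ↦ M (s, 1)) (ζ := -1) (by fun_prop) fun s ↦ by simp [hMe]
  rw [hδa, hδb, hγc, hγd]
  ring

theorem logIncrement_triangle_eq {α : Path a b} {β : Path b c} {γ : Path a c} {δ : Path z w}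
    (hα : Disjoint (range δ) (range α)) (hβ : Disjoint (range δ) (range β))
    (hγ : Disjoint (range δ) (range γ)) :
    logIncrement α z + logIncrement β z - logIncrement γ z =
      logIncrement α w + logIncrement β w - logIncrement γ w := by
  linear_combination logIncrement_sub_logIncrement hγ - logIncrement_sub_logIncrement hα -
    logIncrement_sub_logIncrement hβ

section Cyclic

variable {ι : Type*} [Fintype ι] {p : ι → ℂ} {σ τ : Equiv.Perm ι}
  {A : ∀ i, Path (p (σ i)) (p (τ i))}

theorem exp_sum_logIncrement_eq_one (hz : ∀ i, z ∉ range (A i)) :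
    exp (∑ i, logIncrement (A i) z) = 1 := by
  have hp : ∀ i, p i - z ≠ 0 := fun i h ↦
    hz (σ.symm i) ⟨0, by rw [(A _).source, σ.apply_symm_apply, sub_eq_zero.1 h]⟩
  simp only [exp_sum, exp_logIncrement (hz _), Finset.prod_div_distrib]
  rw [Equiv.prod_comp τ (p · - z), Equiv.prod_comp σ (p · - z)]
  exact div_self (Finset.prod_ne_zero_iff.2 fun i _ ↦ hp i)

theorem sum_logIncrement_eq {δ : Path z w} (h : ∀ i, Disjoint (range δ) (range (A i))) :
    ∑ i, logIncrement (A i) z = ∑ i, logIncrement (A i) w := by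
  rw [← sub_eq_zero, ← neg_eq_zero, neg_sub, ← Finset.sum_sub_distrib]
  simp only [logIncrement_sub_logIncrement (h _), Finset.sum_sub_distrib]
  rw [Equiv.sum_comp τ fun i ↦ logIncrement δ (p i), Equiv.sum_comp σ fun i ↦ logIncrement δ (p i),
    sub_self]

end Cyclic

section Tetrahedron

variable {x y : ℂ} {p : Fin 3 → ℂ} {A : ∀ i, Path (p (i + 1)) (p (i + 2))} {X : ∀ i, Path x (p i)}

/-- The angles of a triangle with curved sides add up to an odd multiple of `π`. -/
theorem exp_sum_logIncrement_vertex_eq_neg_one (hA : ∀ i, p i ∉ range (A i)) :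
    exp (∑ i, logIncrement (A i) (p i)) = -1 := by
  have hne : ∀ i, p (i + 1) - p i ≠ 0 := fun i h ↦ hA i ⟨0, by rw [(A i).source, sub_eq_zero.1 h]⟩
  have h0 : p 1 - p 0 ≠ 0 := hne 0
  have h1 : p 2 - p 1 ≠ 0 := hne 1
  have h2 : p 0 - p 2 ≠ 0 := hne 2
  simp only [exp_sum, exp_logIncrement (hA _), Fin.prod_univ_three, Fin.isValue, Fin.reduceAdd,
    zero_add]
  rw [← neg_sub (p 2) (p 1), ← neg_sub (p 1) (p 0), ← neg_sub (p 0) (p 2)]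
  field_simp

theorem sum_logIncrement_add_sum_triangle (h : ∀ i, Disjoint (range (X i)) (range (A i))) :
    ∑ i, logIncrement (A i) x +
        ∑ i, (logIncrement (X (i + 1)) (p i) + logIncrement (A i) (p i) -
          logIncrement (X (i + 2)) (p i)) =
      2 * ∑ i, logIncrement (A i) (p i) := by
  have h0 := logIncrement_sub_logIncrement (h 0)
  have h1 := logIncrement_sub_logIncrement (h 1)
  have h2 := logIncrement_sub_logIncrement (h 2)
  simp only [Fin.sum_univ_three, Fin.isValue, Fin.reduceAdd, zero_add] at *
  linear_combination - h0 - h1 - h2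

theorem sum_logIncrement_triangle {z : ℂ} :
    ∑ i, (logIncrement (X (i + 1)) z + logIncrement (A i) z - logIncrement (X (i + 2)) z) =
      ∑ i, logIncrement (A i) z := by
  have h1 := Equiv.sum_comp (Equiv.addRight 1) fun i ↦ logIncrement (X i) z
  have h2 := Equiv.sum_comp (Equiv.addRight 2) fun i ↦ logIncrement (X i) z
  simp only [Equiv.coe_addRight] at h1 h2
  rw [Finset.sum_sub_distrib, Finset.sum_add_distrib, h1, h2, add_sub_cancel_left]

theorem not_joinedIn_compl_iUnion_range {Y : ∀ i, Path y (p i)}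
    (hXA : ∀ i, Disjoint (range (X i)) (range (A i)))
    (hYA : ∀ i, Disjoint (range (Y i)) (range (A i)))
    (hXY : ∀ i j, i ≠ j → Disjoint (range (X i)) (range (Y j))) :
    ¬ JoinedIn (⋃ i, range (A i))ᶜ x y := by
  rintro ⟨U, hU⟩
  have hUA : ∀ i, Disjoint (range U) (range (A i)) := fun i ↦
    (disjoint_compl_left.mono_left (range_subset_iff.2 hU)).mono_right
      (subset_iUnion_of_subset i subset_rfl)
  have loop_x : exp (∑ i, logIncrement (A i) x) = 1 :=
    exp_sum_logIncrement_eq_one (σ := Equiv.addRight 1) (τ := Equiv.addRight 2)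
      fun i ↦ disjoint_left.1 (hXA i) ⟨0, (X i).source⟩
  have angle_sum : exp (∑ i, logIncrement (A i) (p i)) = -1 :=
    exp_sum_logIncrement_vertex_eq_neg_one fun i ↦ disjoint_left.1 (hXA i) ⟨1, (X i).target⟩
  have triangles : ∑ i, (logIncrement (X (i + 1)) (p i) + logIncrement (A i) (p i) -
      logIncrement (X (i + 2)) (p i)) = ∑ i, logIncrement (A i) x :=
    calc
      _ = ∑ i, (logIncrement (X (i + 1)) y + logIncrement (A i) y - logIncrement (X (i + 2)) y) :=
        Finset.sum_congr rfl fun i _ ↦ .symm <| logIncrement_triangle_eq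
          (hXY (i + 1) i (by simp)).symm (hYA i) (hXY (i + 2) i (by simp)).symm
      _ = ∑ i, logIncrement (A i) y := sum_logIncrement_triangle
      _ = ∑ i, logIncrement (A i) x :=
        .symm <| sum_logIncrement_eq (σ := Equiv.addRight 1) (τ := Equiv.addRight 2) hUA
  have hsum : ∑ i, logIncrement (A i) (p i) = ∑ i, logIncrement (A i) x := by
    linear_combination (triangles - sum_logIncrement_add_sum_triangle hXA) / 2
  rw [hsum, loop_x] at angle_sum
  norm_num at angle_sum

end Tetrahedron

end LogIncrement

section Graph

variable {V : Type*} {G : SimpleGraph V}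

theorem exists_walk_avoiding_of_isCycle {r a b c : V} {X : G.Walk r r} (hX : X.IsCycle)
    (ha : a ∈ X.support) (hb : b ∈ X.support) (hc : c ∈ X.support) (hac : a ≠ c) (hbc : b ≠ c) :
    ∃ W : G.Walk a b, W.edges ⊆ X.edges ∧ W.support ⊆ X.support ∧ c ∉ W.support := by
  classical
  have hsupport : ∀ {u}, u ∈ (X.rotate c hc).support ↔ u ∈ X.support := by simp
  have hedges : (X.rotate c hc).edges ⊆ X.edges := (X.rotate_edges c hc).perm.subset
  cases hY : X.rotate c hc with
  | nil => exact absurd (hY ▸ hX.rotate hc) (by simp)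
  | cons h q =>
    rw [hY] at hsupport hedges
    have hq : q.IsPath := ((Walk.cons_isCycle_iff q h).1 (hY ▸ hX.rotate hc)).1
    have hqX : q.support ⊆ X.support := fun u hu ↦ hsupport.1 (List.mem_cons_of_mem _ hu)
    have ha' : a ∈ q.support := by simpa [hac] using hsupport.2 ha
    have hb' : b ∈ q.support := by simpa [hbc] using hsupport.2 hb
    refine ⟨(q.takeUntil a ha').reverse.append (q.takeUntil b hb'), fun e he ↦ ?_,
      fun u hu ↦ hqX ?_, fun hu ↦ ?_⟩
    · rw [Walk.edges_append, List.mem_append, Walk.edges_reverse, List.mem_reverse] at he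
      exact hedges <| List.mem_cons_of_mem _ <| he.elim
        (fun h ↦ q.edges_takeUntil_subset_edges ha' h) fun h ↦ q.edges_takeUntil_subset_edges hb' h
    · rw [Walk.mem_support_append_iff, Walk.support_reverse, List.mem_reverse] at hu
      exact hu.elim (fun h ↦ q.support_takeUntil_subset_support ha' h)
        fun h ↦ q.support_takeUntil_subset_support hb' h
    · rw [Walk.mem_support_append_iff, Walk.support_reverse, List.mem_reverse] at hu
      exact hu.elim (Walk.endpoint_notMem_support_takeUntil hq ha' hac.symm)
        (Walk.endpoint_notMem_support_takeUntil hq hb' hbc.symm)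

theorem exists_injective_mem_support_of_isCycle {r : V} {X : G.Walk r r} (hX : X.IsCycle) :
    ∃ t : Fin 3 → V, Function.Injective t ∧ ∀ i, t i ∈ X.support := by
  have h3 := hX.three_le_length
  refine ⟨fun i ↦ X.getVert i, fun i j h ↦ Fin.ext ?_, fun i ↦ X.getVert_mem_support i⟩
  exact hX.getVert_injOn' (Nat.le_sub_one_of_lt (i.isLt.trans_le h3))
    (Nat.le_sub_one_of_lt (j.isLt.trans_le h3)) h

namespace PlaneEmbedding

variable (P : PlaneEmbedding G)

/-- The set of points of the plane that a walk runs through. The points of the vertices are listed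
separately because of walks without edges. -/
def trace {a b : V} (W : G.Walk a b) : Set ℂ :=
  (⋃ e ∈ W.edges, P.curve e) ∪ P.point '' {x | x ∈ W.support}

theorem mem_trace {a b : V} {W : G.Walk a b} {z : ℂ} :
    z ∈ P.trace W ↔ (∃ e ∈ W.edges, z ∈ P.curve e) ∨ ∃ x ∈ W.support, P.point x = z := by
  simp [trace]

theorem joinedIn_curve {x y : V} (h : G.Adj x y) :
    JoinedIn (P.curve s(x, y)) (P.point x) (P.point y) := by
  obtain ⟨γ, -, hγ⟩ := P.curve_isArc x y h
  exact ⟨γ, fun t ↦ hγ ▸ mem_range_self t⟩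

theorem point_mem_curve {e : Sym2 V} (he : e ∈ G.edgeSet) {x : V} (hx : x ∈ e) :
    P.point x ∈ P.curve e := by
  obtain ⟨y, rfl⟩ := hx
  exact (P.joinedIn_curve he).source_mem

theorem joinedIn_trace {a b : V} (W : G.Walk a b) :
    JoinedIn (P.trace W) (P.point a) (P.point b) := by
  induction W with
  | nil => exact JoinedIn.refl (P.mem_trace.2 (Or.inr ⟨_, by simp, rfl⟩))
  | cons h W ih =>
    refine ((P.joinedIn_curve h).mono fun z hz ↦ ?_).trans (ih.mono fun z hz ↦ ?_)
    · exact P.mem_trace.2 (Or.inl ⟨_, by simp, hz⟩)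
    · rw [mem_trace] at hz ⊢
      exact hz.imp (fun ⟨e, he, hz⟩ ↦ ⟨e, by simp [he], hz⟩)
        fun ⟨x, hx, hz⟩ ↦ ⟨x, by simp [hx], hz⟩

theorem disjoint_trace {a b c d : V} {W : G.Walk a b} {W' : G.Walk c d}
    (h : W.support.Disjoint W'.support) : Disjoint (P.trace W) (P.trace W') := by
  rw [Set.disjoint_left]
  intro z hz hz'
  rw [mem_trace] at hz hz'
  rcases hz with ⟨e, he, hz⟩ | ⟨x, hx, rfl⟩ <;> rcases hz' with ⟨f, hf, hz'⟩ | ⟨y, hy, hyz⟩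
  · have hef : e ≠ f := by
      rintro rfl
      induction e with | _ x y =>
      exact h (W.fst_mem_support_of_mem_edges he) (W'.fst_mem_support_of_mem_edges hf)
    obtain ⟨w, ⟨hwe, hwf⟩, -⟩ := P.curve_inter_subset e (W.edges_subset_edgeSet he) f
      (W'.edges_subset_edgeSet hf) hef ⟨hz, hz'⟩
    exact h (W.mem_support_of_mem_edges he hwe) (W'.mem_support_of_mem_edges hf hwf)
  · subst hyz
    exact h (W.mem_support_of_mem_edges he
      (P.mem_of_point_mem_curve e (W.edges_subset_edgeSet he) y hz)) hy
  · exact h hx (W'.mem_support_of_mem_edges hf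
      (P.mem_of_point_mem_curve f (W'.edges_subset_edgeSet hf) x hz'))
  · exact h hx (P.point_injective hyz ▸ hy)

theorem closedCurve_subset_trace {a : V} (X : G.Walk a a) : P.closedCurve X ⊆ P.trace X :=
  subset_union_left

theorem trace_subset_closedCurve {a b c : V} {X : G.Walk a a} (hX : ¬ X.Nil) {W : G.Walk b c}
    (he : W.edges ⊆ X.edges) (hs : W.support ⊆ X.support) : P.trace W ⊆ P.closedCurve X := by
  intro z hz
  rw [closedCurve, mem_iUnion₂]
  rcases P.mem_trace.1 hz with ⟨e, h, hz⟩ | ⟨x, hx, rfl⟩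
  · exact ⟨e, he h, hz⟩
  · obtain ⟨e, h, hxe⟩ := (Walk.mem_support_iff_exists_mem_edges_of_not_nil hX).1 (hs hx)
    exact ⟨e, h, P.point_mem_curve (X.edges_subset_edgeSet h) hxe⟩

theorem point_mem_closedCurve_iff {a x : V} {X : G.Walk a a} (hX : ¬ X.Nil) :
    P.point x ∈ P.closedCurve X ↔ x ∈ X.support := by
  refine ⟨fun h ↦ ?_, fun h ↦ P.trace_subset_closedCurve hX (List.Subset.refl _)
    (List.Subset.refl _) (P.mem_trace.2 (Or.inr ⟨x, h, rfl⟩))⟩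
  rw [closedCurve, mem_iUnion₂] at h
  obtain ⟨e, he, h⟩ := h
  exact X.mem_support_of_mem_edges he (P.mem_of_point_mem_curve e (X.edges_subset_edgeSet he) x h)

theorem isClosed_closedCurve {a : V} (X : G.Walk a a) : IsClosed (P.closedCurve X) := by
  refine Set.Finite.isClosed_biUnion (List.finite_toSet X.edges) fun e he ↦ ?_
  have hadj := X.edges_subset_edgeSet he
  induction e with | _ x y =>
  obtain ⟨γ, -, hγ⟩ := P.curve_isArc x y hadj
  exact hγ ▸ (isCompact_range γ.continuous).isClosed

theorem oppositeSides_iff {a x y : V} {X : G.Walk a a} (hX : ¬ X.Nil) :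
    P.OppositeSides X x y ↔ x ∉ X.support ∧ y ∉ X.support ∧
      ¬ JoinedIn (P.closedCurve X)ᶜ (P.point x) (P.point y) := by
  rw [OppositeSides, P.point_mem_closedCurve_iff hX, P.point_mem_closedCurve_iff hX]
  refine and_congr_right fun hx ↦ and_congr_right fun hy ↦ not_congr ⟨fun h ↦ ?_, ?_⟩
  · have hx' := (P.point_mem_closedCurve_iff hX).not.2 hx
    have hy' := (P.point_mem_closedCurve_iff hX).not.2 hy
    have hpc := (P.isClosed_closedCurve X).isOpen_compl.connectedComponentIn
      |>.isConnected_iff_isPathConnected.1 (isConnected_connectedComponentIn_iff.2 hx')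
    exact (hpc.joinedIn _ (mem_connectedComponentIn hx') _
      (h ▸ mem_connectedComponentIn hy')).mono (connectedComponentIn_subset _ _)
  · rintro ⟨γ, hγ⟩
    exact connectedComponentIn_eq <| (isPreconnected_range γ.continuous).subset_connectedComponentIn
      ⟨0, γ.source⟩ (range_subset_iff.2 hγ) ⟨1, γ.target⟩

theorem joinedIn_compl_closedCurve_of_adj {a x y : V} {X : G.Walk a a} (hx : x ∉ X.support)
    (hy : y ∉ X.support) (h : G.Adj x y) :
    JoinedIn (P.closedCurve X)ᶜ (P.point x) (P.point y) := by
  have hdisj : Disjoint (P.trace h.toWalk) (P.trace X) := P.disjoint_trace (by simp [hx, hy])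
  exact (P.joinedIn_trace h.toWalk).mono
    (hdisj.mono_right (P.closedCurve_subset_trace X)).subset_compl_right

theorem oppositeSides_of_three_common_neighbors {r : V} {X : G.Walk r r} (hX : X.IsCycle) {x y : V}
    (hxy : x ≠ y) (hx : x ∉ X.support) (hy : y ∉ X.support) {t : Fin 3 → V}
    (ht : Function.Injective t) (htX : ∀ i, t i ∈ X.support) (hxt : ∀ i, G.Adj x (t i))
    (hyt : ∀ i, G.Adj y (t i)) : P.OppositeSides X x y := by
  refine (P.oppositeSides_iff hX.not_nil).2 ⟨hx, hy, fun hU ↦ ?_⟩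
  choose W hWe hWs htW using fun i : Fin 3 ↦ exists_walk_avoiding_of_isCycle hX (htX (i + 1))
    (htX (i + 2)) (htX i) (ht.ne (by simp)) (ht.ne (by simp))
  choose A hA using fun i ↦ P.joinedIn_trace (W i)
  choose γ hγ using fun i ↦ P.joinedIn_trace (hxt i).toWalk
  choose δ hδ using fun i ↦ P.joinedIn_trace (hyt i).toWalk
  have hspoke : ∀ {z : V} (i) (h : G.Adj z (t i)), z ∉ X.support →
      Disjoint (P.trace h.toWalk) (P.trace (W i)) := fun i h hz ↦
    P.disjoint_trace (by simpa [htW i] using fun hzW ↦ hz (hWs i hzW))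
  have hspokes : ∀ i j, i ≠ j → Disjoint (P.trace (hxt i).toWalk) (P.trace (hyt j).toWalk) :=
    fun i j hij ↦ P.disjoint_trace <| by
      simp [hxy.symm, ht.eq_iff, hij.symm, (ne_of_mem_of_not_mem (htX i) hy).symm,
        ne_of_mem_of_not_mem (htX j) hx]
  simp only [← range_subset_iff] at hA hγ hδ
  refine not_joinedIn_compl_iUnion_range (p := P.point ∘ t) (A := A)
    (fun i ↦ (hspoke i (hxt i) hx).mono (hγ i) (hA i))
    (fun i ↦ (hspoke i (hyt i) hy).mono (hδ i) (hA i))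
    (fun i j hij ↦ (hspokes i j hij).mono (hγ i) (hδ j)) (hU.mono (compl_subset_compl.2 ?_))
  exact iUnion_subset fun i ↦
    (hA i).trans (P.trace_subset_closedCurve hX.not_nil (hWe i) (hWs i))

theorem oppositeSides_of_isCycle_subset {r r' : V} {X : G.Walk r r} (hX : X.IsCycle)
    {X' : G.Walk r' r'} (hX' : X'.IsCycle) (hsub : X'.support ⊆ X.support) {x y : V} (hxy : x ≠ y)
    (hx : x ∉ X.support) (hy : y ∉ X.support) (hxX' : ∀ t ∈ X'.support, G.Adj x t)
    (hyX' : ∀ t ∈ X'.support, G.Adj y t) : P.OppositeSides X x y := by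
  obtain ⟨t, ht, htX'⟩ := exists_injective_mem_support_of_isCycle hX'
  exact P.oppositeSides_of_three_common_neighbors hX hxy hx hy ht (fun i ↦ hsub (htX' i))
    (fun i ↦ hxX' _ (htX' i)) fun i ↦ hyX' _ (htX' i)

/-- If `x` and `z` were on the same side of `X`, then no vertex of `X'` could be off `X`, since it
would connect `y` with `z`. -/
theorem OppositeSides.of_isCycle_adj {r r' : V} {X : G.Walk r r} (hX : X.IsCycle)
    {X' : G.Walk r' r'} (hX' : X'.IsCycle) {x y z : V} (hxX : ∀ t ∈ X.support, G.Adj x t)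
    (hyX' : ∀ t ∈ X'.support, G.Adj y t) (hzX' : ∀ t ∈ X'.support, G.Adj z t) (hxz : x ≠ z)
    (hz : z ∉ X.support) (hxy : P.OppositeSides X x y) : P.OppositeSides X x z := by
  obtain ⟨hx, hy, hsep⟩ := (P.oppositeSides_iff hX.not_nil).1 hxy
  by_contra hnot
  have hjoin : JoinedIn (P.closedCurve X)ᶜ (P.point x) (P.point z) := by
    simpa [P.oppositeSides_iff hX.not_nil, hx, hz] using hnot
  have hsub : X'.support ⊆ X.support := fun t ht ↦ by_contra fun htX ↦ hsep <|
    (hjoin.trans (P.joinedIn_compl_closedCurve_of_adj hz htX (hzX' t ht))).trans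
      (P.joinedIn_compl_closedCurve_of_adj hy htX (hyX' t ht)).symm
  exact hnot <| P.oppositeSides_of_isCycle_subset hX hX' hsub hxz hx hz
    (fun t ht ↦ hxX t (hsub ht)) hzX'

end PlaneEmbedding

/-- Two vertices are cycle-linked if some cycle has all its vertices adjacent to both: the relation
between consecutive vertices of a color fixation chain that the separation argument uses. -/
def CycleLinked (G : SimpleGraph V) (x y : V) : Prop :=
  ∃ (a : V) (X : G.Walk a a), X.IsCycle ∧ ∀ t ∈ X.support, G.Adj x t ∧ G.Adj y t

instance : Std.Symm (CycleLinked G) where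
  symm _ _ := fun ⟨a, X, hX, h⟩ ↦ ⟨a, X, hX, fun t ht ↦ (h t ht).symm⟩

theorem cycleLinked_of_chromaticNumber {C : G.Subgraph} {x y : V} (hC : 2 < C.coe.chromaticNumber)
    (hx : ∀ t ∈ C.verts, G.Adj x t) (hy : ∀ t ∈ C.verts, G.Adj y t) : CycleLinked G x y := by
  have hcyc : ¬ C.coe.IsAcyclic := fun h ↦ hC.not_ge h.chromaticNumber_le_two
  simp only [IsAcyclic, not_forall, not_not] at hcyc
  obtain ⟨a, X, hX⟩ := hcyc
  refine ⟨_, X.map C.hom, hX.map C.hom_injective, fun t ht ↦ ?_⟩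
  rw [Walk.support_map, List.mem_map] at ht
  obtain ⟨s, -, rfl⟩ := ht
  exact ⟨hx _ s.2, hy _ s.2⟩

theorem exists_last_departure {α : Type*} {R : α → α → Prop} {x y : α}
    (h : Relation.ReflTransGen R x y) (hxy : x ≠ y) :
    ∃ z, x ≠ z ∧ R x z ∧ Relation.ReflTransGen (fun p q ↦ R p q ∧ x ≠ q) z y := by
  induction h with
  | refl => exact absurd rfl hxy
  | @tail p q _ hpq ih =>
    obtain rfl | hxp := eq_or_ne x p
    · exact ⟨q, hxy, hpq, .refl⟩
    · obtain ⟨z, hxz, hRxz, hzp⟩ := ih hxp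
      exact ⟨z, hxz, hRxz, hzp.tail ⟨hpq, hxy⟩⟩

theorem reflTransGen_of_castSucc_succ {n : ℕ} {R : Fin (n + 1) → Fin (n + 1) → Prop} [Std.Symm R]
    (h : ∀ k : Fin n, R k.castSucc k.succ) (i j : Fin (n + 1)) : Relation.ReflTransGen R i j := by
  have from_zero : ∀ k, Relation.ReflTransGen R 0 k := fun k ↦ by
    induction k using Fin.induction with
    | zero => exact .refl
    | succ k ih => exact ih.tail (h k)
  exact (symm (from_zero i)).trans (from_zero j)

theorem PlaneEmbedding.exists_isCycle_oppositeSides (P : PlaneEmbedding G) {x y : V} (hxy : x ≠ y)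
    (h : Relation.ReflTransGen (fun p q ↦ CycleLinked G p q ∧ ¬ G.Adj x q) x y) :
    ∃ (a : V) (X : G.Walk a a), X.IsCycle ∧ P.OppositeSides X x y := by
  obtain ⟨z, hxz, ⟨⟨a, X, hX, hXadj⟩, -⟩, hzy⟩ := exists_last_departure h hxy
  have hxX : ∀ t ∈ X.support, G.Adj x t := fun t ht ↦ (hXadj t ht).1
  have hzX : ∀ t ∈ X.support, G.Adj z t := fun t ht ↦ (hXadj t ht).2
  refine ⟨a, X, hX, ?_⟩
  clear hxy h
  induction hzy with
  | refl =>
    exact P.oppositeSides_of_isCycle_subset hX hX (List.Subset.refl _) hxz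
      (fun h ↦ (hxX x h).ne rfl) (fun h ↦ (hzX z h).ne rfl) hxX hzX
  | tail _ hpq ih =>
    obtain ⟨⟨⟨b, X', hX', hX'adj⟩, hxq⟩, hne⟩ := hpq
    exact OppositeSides.of_isCycle_adj P hX hX' hxX (fun t ht ↦ (hX'adj t ht).1)
      (fun t ht ↦ (hX'adj t ht).2) hne (fun h ↦ hxq (hxX _ h)) ih

namespace IsColorFixationChain

variable {k n : ℕ} {v : Fin (n + 1) → V} {C : Fin n → G.Subgraph}

theorem cycleLinked (h : IsColorFixationChain G k v C) (hk : 3 < k) (i : Fin n) :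
    CycleLinked G (v i.castSucc) (v i.succ) :=
  cycleLinked_of_chromaticNumber (by rw [(h.critical i).1]; exact_mod_cast Nat.lt_sub_of_add_lt hk)
    ((h.vertex_fixed i).2 _ (by simp)) ((h.vertex_succ_fixed i).2 _ (by simp))

theorem color_castSucc_eq_color_succ (h : IsColorFixationChain G k v C) (c : G.Coloring (Fin k))
    (i : Fin n) : c (v i.castSucc) = c (v i.succ) := by
  have hk : 0 < k := (c (v i.succ)).pos
  have hC : (C i).coe.chromaticNumber = (k - 1 : ℕ) := (h.critical i).1
  obtain ⟨⟨j, l, hjl, -, hl, hcycle⟩, -⟩ := h.cycle_fixed i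
  obtain ⟨⟨j', l', -, hj', -, hvertex⟩, -⟩ := h.vertex_fixed i
  obtain rfl : l = k - 1 := by exact_mod_cast hl.symm.trans hC
  obtain rfl : j' = k - 1 := by exact_mod_cast hj'.symm.trans hC
  have hCcolors := hcycle c {c (v i.succ)} (by rw [Finset.card_singleton]; omega) (by simp)
  have hvcolors :=
    hvertex c {c (v i.succ)}ᶜ (by simp [Finset.card_compl]) (by simpa using hCcolors)
  simpa using hvcolors

theorem color_eq_color (h : IsColorFixationChain G k v C) (c : G.Coloring (Fin k))
    (i j : Fin (n + 1)) : c (v i) = c (v j) := by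
  have eq_zero : ∀ m, c (v m) = c (v 0) := fun m ↦ by
    induction m using Fin.induction with
    | zero => rfl
    | succ m ih => exact (h.color_castSucc_eq_color_succ c m).symm.trans ih
  exact (eq_zero i).trans (eq_zero j).symm

end IsColorFixationChain

end Graph

end ColorFixation

open ColorFixation in
theorem lemma5_general {V : Type*} {G : SimpleGraph V} (P : PlaneEmbedding G) {n : ℕ}
    (v : Fin (n + 1) → V) (hlink : ∀ k : Fin n, CycleLinked G (v k.castSucc) (v k.succ))
    {i j : Fin (n + 1)} (hadj : ∀ k, ¬ G.Adj (v i) (v k)) (hij : v i ≠ v j) :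
    ∃ (a : V) (X : G.Walk a a), X.IsCycle ∧ P.OppositeSides X (v i) (v j) := by
  have : Std.Symm fun k l ↦ CycleLinked G (v k) (v l) := ⟨fun _ _ h ↦ symm h⟩
  exact P.exists_isCycle_oppositeSides hij <|
    Relation.ReflTransGen.lift v (fun _ l h ↦ ⟨h, hadj l⟩) _ _ <|
      reflTransGen_of_castSucc_succ (R := fun k l ↦ CycleLinked G (v k) (v l)) hlink i j

theorem lemma5 {V : Type*} (G : SimpleGraph V) (hG : G.chromaticNumber = 4)
    (P : ColorFixation.PlaneEmbedding G) {n : ℕ} (v : Fin (n + 1) → V) (C : Fin n → G.Subgraph)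
    (hC : ColorFixation.IsColorFixationChain G 4 v C) (i j : Fin (n + 1)) (hij : v i ≠ v j) :
    ¬ P.Adjaceable (v i) (v j) := by
  obtain ⟨c⟩ : G.Colorable 4 := SimpleGraph.chromaticNumber_le_iff_colorable.1 hG.le
  exact fun h ↦ h.2 (lemma5_general P v (hC.cycleLinked (by norm_num))
    (fun k hk ↦ c.valid hk (hC.color_eq_color c i k)) hij)
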